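/- Let $X=\{X_u : u\in U\}$ be a real-valued centered Gaussian process on a probability space $(\Omega,\mathcal A,\mathbb P)$, indexed by a nonempty pseudo-metric space $(U,d)$; that is, all finite-dimensional marginals of $X$ are (possibly degenerate) multivariate normal with mean zero. Suppose that $X$ is separable: there are a countable set $U_0\subseteq U$ and an event $\Omega_0$ with $\mathbb P(\Omega_0)=1$ such that $X_u(\omega)\in\overline{\{X_v(\omega): v\in U_0,\ d(u,v)<\varepsilon\}}$ for all $\omega\in\Omega_0$, $u\in U$ and $\varepsilon>0$. Suppose also that $\mathrm{Var}(X_u)\ge\underline\sigma^2$ for all $u\in U$, where $\underline\sigma>0$. Set $Z=\sup_{u\in U}X_u$ and assume that $Z<\infty$ almost surely. Then $Z$ is integrable, $0\le\mathbb E[Z]<\infty$, and $$\mathrm{Var}(Z)\ \ge\ \frac{1}{15^2}\left(\frac{\underline\sigma}{1+\mathbb E[Z/\underline\sigma]}\right)^2 .$$ The same conclusions hold with $Z$ replaced by $\widetilde Z=\sup_{u\in U}|X_u|$, if $\widetilde Z<\infty$ almost surely. -/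

import Mathlib

open MeasureTheory ProbabilityTheory

/-- A real stochastic process `X` indexed by a pseudo-metric space `U` is separable: there are a
countable `U₀ ⊆ U` and an almost sure event on which, for every `u : U` and every `ε > 0`,
the value `X u ω` lies in the closure of `{X v ω | v ∈ U₀, dist v u < ε}`. -/
def IsSeparableProcess {Ω U : Type*} [MeasurableSpace Ω] [PseudoMetricSpace U]
    (X : U → Ω → ℝ) (P : Measure Ω) : Prop :=
  ∃ U₀ : Set U, U₀.Countable ∧
    ∀ᵐ ω ∂P, ∀ u : U, ∀ ε : ℝ, 0 < ε →
      X u ω ∈ closure ((fun v => X v ω) '' (U₀ ∩ Metric.ball u ε))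

/-- A real stochastic process is a centered Gaussian process: its finite-dimensional marginals are
(possibly degenerate) multivariate normal, with mean zero. -/
structure IsCenteredGaussianProcess {Ω U : Type*} [MeasurableSpace Ω]
    (X : U → Ω → ℝ) (P : Measure Ω) : Prop where
  isGaussian : IsGaussianProcess X P
  mean_zero : ∀ u, ∫ ω, X u ω ∂P = 0

open Set Filter Topology
open scoped ENNReal NNReal

/-! The supremum cannot concentrate too sharply: raising a level `t ≥ 0` by `s` keeps at least the
fraction `1 - (s/σ)(1 + t/σ)` of the probability of exceeding it (`mul_measure_exists_nat_gt_le`).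
If the variance were too small, Chebyshev would put most of the mass of `Z` in a short window around
its mean, and crossing that window would cost more than this allows.

For one standard Gaussian the fraction comes from Mills' ratio. For finitely many normalised
variables, split according to the index `j` at which `W k - a k` is first maximal. Given the
residuals of the regression on `W j`, which are independent of `W j`, this event is an upper set in
`W j`, because correlations are at most 1. The one-dimensional bound therefore applies on each
piece, and the pieces are disjoint, so nothing is lost with the number of variables.

Separability reduces the supremum to a sequence, and Fernique's theorem, uniformly in the dimension,
gives square-integrability. -/

/-! ### Gaussian tails and upper sets -/

/-- Mills' ratio bound for the standard Gaussian density. -/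
lemma gaussianPDFReal_le_mul_integral_Ioi {x : ℝ} (hx : 0 ≤ x) :
    gaussianPDFReal 0 1 x ≤ (x + 1) * ∫ y in Ioi x, gaussianPDFReal 0 1 y := by
  -- For `y ≥ 0` this derivative is at most the density, since `y ^ 2 + y + 1 ≤ (y + 1) ^ 2`;
  -- integrating over `Ioi x` gives the bound.
  have hderiv : ∀ y ∈ Ici x, HasDerivAt (fun y ↦ -(gaussianPDFReal 0 1 y / (y + 1)))
      (gaussianPDFReal 0 1 y * ((y ^ 2 + y + 1) / (y + 1) ^ 2)) y := by
    intro y hy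
    have hy' : y + 1 ≠ 0 := by have : x ≤ y := hy; linarith
    have h1 : HasDerivAt (gaussianPDFReal 0 1) (gaussianPDFReal 0 1 y * (-y)) y := by
      have h2 : HasDerivAt (fun z : ℝ ↦ -(z - 0) ^ 2 / (2 * ((1 : ℝ≥0) : ℝ))) (-y) y :=
        (((((hasDerivAt_id y).sub_const 0).pow 2).neg).div_const (2 * ((1 : ℝ≥0) : ℝ))).congr_deriv
          (by simp; ring)
      refine ((h2.exp).const_mul (√(2 * Real.pi * ((1 : ℝ≥0) : ℝ)))⁻¹).congr_deriv ?_
      rw [gaussianPDFReal_def]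
      exact (mul_assoc _ _ _).symm
    refine ((h1.div ((hasDerivAt_id y).add_const 1) hy').neg).congr_deriv ?_
    simp only [id]
    field_simp
    ring
  have hnonneg : ∀ y ∈ Ioi x, 0 ≤ gaussianPDFReal 0 1 y * ((y ^ 2 + y + 1) / (y + 1) ^ 2) := by
    intro y hy
    have : 0 ≤ y := hx.trans (mem_Ioi.1 hy).le
    exact mul_nonneg (gaussianPDFReal_nonneg _ _ _) (by positivity)
  have hle : ∀ y, gaussianPDFReal 0 1 y ≤ 1 := by
    intro y
    rw [gaussianPDFReal]
    refine mul_le_one₀ ?_ (Real.exp_nonneg _) ?_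
    · refine inv_le_one_of_one_le₀ (Real.one_le_sqrt.2 ?_)
      simp only [NNReal.coe_one, mul_one]
      linarith [Real.pi_gt_three]
    · simp only [Real.exp_le_one_iff]
      exact div_nonpos_of_nonpos_of_nonneg (by nlinarith [sq_nonneg (y - 0)]) (by simp)
  have hlim : Tendsto (fun y ↦ -(gaussianPDFReal 0 1 y / (y + 1))) atTop (𝓝 0) := by
    suffices Tendsto (fun y ↦ gaussianPDFReal 0 1 y / (y + 1)) atTop (𝓝 0) by simpa using this.neg
    have h0 : Tendsto (fun y : ℝ ↦ 1 / (y + 1)) atTop (𝓝 0) := by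
      simpa [Function.comp_def] using tendsto_inv_atTop_zero.comp
        (tendsto_atTop_add_const_right _ (1 : ℝ) tendsto_id)
    refine squeeze_zero' ?_ ?_ h0
    · filter_upwards [eventually_ge_atTop 0] with y hy
      exact div_nonneg (gaussianPDFReal_nonneg _ _ _) (by positivity)
    · filter_upwards [eventually_ge_atTop 0] with y hy
      exact div_le_div_of_nonneg_right (hle y) (by positivity)
  have hint := integrableOn_Ioi_deriv_of_nonneg' hderiv hnonneg hlim
  have heq := integral_Ioi_of_hasDerivAt_of_nonneg' hderiv hnonneg hlim
  have hmono : ∫ y in Ioi x, gaussianPDFReal 0 1 y * ((y ^ 2 + y + 1) / (y + 1) ^ 2)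
      ≤ ∫ y in Ioi x, gaussianPDFReal 0 1 y := by
    refine setIntegral_mono_on hint (integrable_gaussianPDFReal _ _).integrableOn
      measurableSet_Ioi fun y hy ↦ ?_
    have : 0 ≤ y := hx.trans (mem_Ioi.1 hy).le
    refine mul_le_of_le_one_right (gaussianPDFReal_nonneg _ _ _) ?_
    rw [div_le_one (by positivity)]
    nlinarith
  rw [heq] at hmono
  have : gaussianPDFReal 0 1 x / (x + 1) ≤ ∫ y in Ioi x, gaussianPDFReal 0 1 y := by linarith
  rwa [div_le_iff₀ (by positivity), mul_comm] at this

lemma gaussianPDFReal_zero_le_of_le {x y : ℝ} (v : ℝ≥0) (hx : 0 ≤ x) (hxy : x ≤ y) :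
    gaussianPDFReal 0 v y ≤ gaussianPDFReal 0 v x := by
  simp only [gaussianPDFReal, sub_zero]
  gcongr

/-- Lower bound for the ratio of two Gaussian tails. -/
lemma mul_gaussianReal_Ioi_le {x s t : ℝ} (hx : 0 ≤ x) (hxt : x ≤ t) (hs : 0 ≤ s) :
    ENNReal.ofReal (1 - s * (1 + t)) * gaussianReal 0 1 (Ioi x)
      ≤ gaussianReal 0 1 (Ioi (x + s)) := by
  rw [gaussianReal_apply_eq_integral _ one_ne_zero, gaussianReal_apply_eq_integral _ one_ne_zero,
    ← ENNReal.ofReal_mul' (setIntegral_nonneg measurableSet_Ioi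
      fun y _ ↦ gaussianPDFReal_nonneg _ _ _)]
  refine ENNReal.ofReal_le_ofReal ?_
  have hmills := gaussianPDFReal_le_mul_integral_Ioi hx
  set F := ∫ y in Ioi x, gaussianPDFReal 0 1 y with hF
  have hF0 : 0 ≤ F := setIntegral_nonneg measurableSet_Ioi fun y _ ↦ gaussianPDFReal_nonneg _ _ _
  have hsplit : F = (∫ y in Ioc x (x + s), gaussianPDFReal 0 1 y)
      + ∫ y in Ioi (x + s), gaussianPDFReal 0 1 y := by
    rw [hF, ← Ioc_union_Ioi_eq_Ioi (by linarith : x ≤ x + s)]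
    exact setIntegral_union (Ioc_disjoint_Ioi le_rfl) measurableSet_Ioi
      (integrable_gaussianPDFReal _ _).integrableOn (integrable_gaussianPDFReal _ _).integrableOn
  have hIoc : ∫ y in Ioc x (x + s), gaussianPDFReal 0 1 y ≤ s * gaussianPDFReal 0 1 x := by
    calc ∫ y in Ioc x (x + s), gaussianPDFReal 0 1 y
        ≤ ∫ y in Ioc x (x + s), gaussianPDFReal 0 1 x :=
          setIntegral_mono_on (integrable_gaussianPDFReal _ _).integrableOn (by simp)
            measurableSet_Ioc fun y hy ↦ gaussianPDFReal_zero_le_of_le _ hx hy.1.le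
      _ = s * gaussianPDFReal 0 1 x := by simp [hs]
  have h1 : s * gaussianPDFReal 0 1 x ≤ s * ((x + 1) * F) := by gcongr
  have h2 : s * ((x + 1) * F) ≤ s * ((t + 1) * F) := by gcongr
  linarith

/-- An upper set of reals either contains `Ioi (x + s)`, which leaves the comparison of pure tails,
or lies inside it, and then the shift removes nothing. -/
lemma IsUpperSet.mul_gaussianReal_inter_Ioi_le {S : Set ℝ} (hS : IsUpperSet S) {x s t : ℝ}
    (hx : 0 ≤ x) (hxt : x ≤ t) (hs : 0 ≤ s) :
    ENNReal.ofReal (1 - s * (1 + t)) * gaussianReal 0 1 (S ∩ Ioi x)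
      ≤ gaussianReal 0 1 (S ∩ Ioi (x + s)) := by
  by_cases h : ∃ y ∈ S, y ≤ x + s
  · obtain ⟨y, hyS, hy⟩ := h
    rw [inter_eq_self_of_subset_right (fun z hz ↦ hS (hy.trans (mem_Ioi.1 hz).le) hyS)]
    exact le_trans (by gcongr; exact inter_subset_right) (mul_gaussianReal_Ioi_le hx hxt hs)
  · push Not at h
    rw [inter_eq_self_of_subset_left (t := Ioi (x + s)) fun y hy ↦ h y hy]
    refine (mul_le_mul_right (measure_mono inter_subset_left) _).trans ?_
    refine mul_le_of_le_one_left zero_le (ENNReal.ofReal_le_one.2 ?_)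
    have : 0 ≤ s * (1 + t) := mul_nonneg hs (by linarith)
    linarith

/-- By independence and Fubini, the bound for upper sets can be applied section by section, with `V`
frozen. -/
lemma ProbabilityTheory.IndepFun.mul_measure_inter_gt_le {Ω E : Type*} [MeasurableSpace Ω]
    [MeasurableSpace E] {P : Measure Ω} [IsFiniteMeasure P] {V : Ω → E} {W : Ω → ℝ}
    (hVW : IndepFun V W P)
    (hV : AEMeasurable V P) (hW : AEMeasurable W P) (hlaw : P.map W = gaussianReal 0 1)
    {S : Set (E × ℝ)} (hS : MeasurableSet S) (hup : ∀ v, IsUpperSet (Prod.mk v ⁻¹' S))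
    {x s t : ℝ} (hx : 0 ≤ x) (hxt : x ≤ t) (hs : 0 ≤ s) :
    ENNReal.ofReal (1 - s * (1 + t)) * P {ω | (V ω, W ω) ∈ S ∧ x < W ω}
      ≤ P {ω | (V ω, W ω) ∈ S ∧ x + s < W ω} := by
  have key : ∀ c : ℝ, P {ω | (V ω, W ω) ∈ S ∧ c < W ω}
      = ∫⁻ v, gaussianReal 0 1 (Prod.mk v ⁻¹' S ∩ Ioi c) ∂(P.map V) := by
    intro c
    have hm : MeasurableSet (S ∩ Prod.snd ⁻¹' Ioi c) :=
      hS.inter (measurable_snd measurableSet_Ioi)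
    have h1 : {ω | (V ω, W ω) ∈ S ∧ c < W ω}
      = (fun ω ↦ (V ω, W ω)) ⁻¹' (S ∩ Prod.snd ⁻¹' Ioi c) := rfl
    rw [h1, ← Measure.map_apply_of_aemeasurable (hV.prodMk hW) hm,
      (indepFun_iff_map_prod_eq_prod_map_map hV hW).1 hVW, hlaw, Measure.prod_apply hm]
    rfl
  rw [key, key, ← lintegral_const_mul']
  · exact lintegral_mono fun v ↦ (hup v).mul_gaussianReal_inter_Ioi_le hx hxt hs
  · exact ENNReal.ofReal_ne_top

section

variable {Ω : Type*} [MeasurableSpace Ω] {P : Measure Ω}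

/-! ### Decomposition by the first maximiser -/

/-- The correlation of two square-integrable variables of unit variance is at most one. -/
lemma covariance_le_one_of_variance_eq_one [IsProbabilityMeasure P] {A B : Ω → ℝ}
    (hA : MemLp A 2 P) (hB : MemLp B 2 P) (hA1 : Var[A; P] = 1) (hB1 : Var[B; P] = 1) :
    cov[A, B; P] ≤ 1 := by
  have h := variance_nonneg (A - B) P
  rw [variance_sub hA hB] at h
  linarith

/-- In a centered Gaussian process `W` of unit variances, each variable is independent of the
residuals of the process after regression on it. -/
lemma ProbabilityTheory.IsGaussianProcess.indepFun_residual {ι : Type*} {W : ι → Ω → ℝ}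
    (hW : IsGaussianProcess W P) (j : ι) (hj : Var[W j; P] = 1) :
    IndepFun (fun ω k ↦ W k ω - cov[W k, W j; P] * W j ω) (W j) P := by
  classical
  have hP := hW.isProbabilityMeasure
  have hL2 : ∀ k, MemLp (W k) 2 P := fun k ↦ (hW.hasGaussianLaw_eval k).memLp_two
  -- Joint Gaussianity of residuals and regressor is what turns zero covariance into independence.
  have hG : IsGaussianProcess
      (Sum.elim (fun k ω ↦ W k ω - cov[W k, W j; P] * W j ω) fun _ : Unit ↦ W j) P := by
    refine hW.of_isGaussianProcess ?_
    rintro (k | u)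
    · refine ⟨{k, j}, ContinuousLinearMap.proj ⟨k, by simp⟩
        - cov[W k, W j; P] • ContinuousLinearMap.proj ⟨j, by simp⟩, fun ω ↦ ?_⟩
      simp
    · exact ⟨{j}, ContinuousLinearMap.proj ⟨j, by simp⟩, fun ω ↦ by simp⟩
  have h := hG.indepFun_of_covariance_eq_zero
    (fun k ↦ (hW.aemeasurable k).sub ((hW.aemeasurable j).const_mul _))
    (fun _ ↦ hW.aemeasurable j) (fun k _ ↦ by
      rw [covariance_fun_sub_left (hL2 k) ((hL2 j).const_mul _) (hL2 j),
        covariance_const_mul_left, covariance_self (hW.aemeasurable j), hj]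
      ring)
  exact h.comp measurable_id (measurable_pi_apply ())

/-- The points of `I` at which `D` attains its maximum over `I` for the first time. -/
def IsFirstArgmax {ι : Type*} [LinearOrder ι] (I : Finset ι) (D : ι → ℝ) (j : ι) : Prop :=
  ∀ k ∈ I, (k < j → D k < D j) ∧ (j < k → D k ≤ D j)

lemma exists_isFirstArgmax {ι : Type*} [LinearOrder ι] {I : Finset ι} (hI : I.Nonempty)
    (D : ι → ℝ) : ∃ j ∈ I, IsFirstArgmax I D j := by
  -- The lexicographic order with reversed index breaks ties in favour of the smallest index.
  obtain ⟨j, hj, hmax⟩ := I.exists_max_image (fun k ↦ toLex (D k, OrderDual.toDual k)) hI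
  refine ⟨j, hj, fun k hk ↦ ?_⟩
  have := hmax k hk
  rw [Prod.Lex.toLex_le_toLex] at this
  simp only [OrderDual.toDual_le_toDual] at this
  refine ⟨fun hkj ↦ ?_, fun hjk ↦ ?_⟩
  · exact this.resolve_right fun h ↦ absurd h.2 (not_le.2 hkj)
  · exact this.elim le_of_lt fun h ↦ h.1.le

lemma IsFirstArgmax.eq {ι : Type*} [LinearOrder ι] {I : Finset ι} {D : ι → ℝ} {i j : ι}
    (hi : i ∈ I) (hj : j ∈ I) (h : IsFirstArgmax I D i) (h' : IsFirstArgmax I D j) : i = j := by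
  rcases lt_trichotomy i j with hij | hij | hij
  · exact absurd ((h j hj).2 hij) (not_le.2 ((h' i hi).1 hij))
  · exact hij
  · exact absurd ((h' i hi).2 hij) (not_le.2 ((h j hj).1 hij))

lemma IsFirstArgmax.le {ι : Type*} [LinearOrder ι] {I : Finset ι} {D : ι → ℝ} {j k : ι}
    (h : IsFirstArgmax I D j) (hk : k ∈ I) : D k ≤ D j := by
  rcases lt_trichotomy k j with hij | rfl | hij
  · exact ((h k hk).1 hij).le
  · exact le_rfl
  · exact (h k hk).2 hij

/-- For finitely many Gaussian variables with unit variances and individual thresholds in `[0, t]`,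
raising all the thresholds by `s` costs a controlled factor of the exceedance probability. -/
lemma ProbabilityTheory.IsGaussianProcess.mul_measure_exists_gt_le {ι : Type*} [Countable ι]
    [LinearOrder ι]
    {W : ι → Ω → ℝ} (hW : IsGaussianProcess W P) (hmean : ∀ k, ∫ ω, W k ω ∂P = 0)
    (hvar : ∀ k, Var[W k; P] = 1) (I : Finset ι) {a : ι → ℝ} {s t : ℝ} (ha : ∀ k, 0 ≤ a k)
    (hat : ∀ k, a k ≤ t) (hs : 0 ≤ s) :
    ENNReal.ofReal (1 - s * (1 + t)) * P {ω | ∃ k ∈ I, a k < W k ω}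
      ≤ P {ω | ∃ k ∈ I, a k + s < W k ω} := by
  have hP := hW.isProbabilityMeasure
  have hL2 : ∀ k, MemLp (W k) 2 P := fun k ↦ (hW.hasGaussianLaw_eval k).memLp_two
  let D : Ω → ι → ℝ := fun ω k ↦ W k ω - a k
  let ρ : ι → ι → ℝ := fun j k ↦ cov[W k, W j; P]
  let V : ι → Ω → ι → ℝ := fun j ω k ↦ W k ω - ρ j k * W j ω
  -- The first-maximiser event written in the independent coordinates, through `W k = V j k + ρ j k
  -- * W j`.
  let S : ι → Set ((ι → ℝ) × ℝ) := fun j ↦ {p | ∀ k ∈ I,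
    (k < j → p.1 k + ρ j k * p.2 - a k < p.2 - a j) ∧
    (j < k → p.1 k + ρ j k * p.2 - a k ≤ p.2 - a j)}
  have hVS : ∀ j ω, (V j ω, W j ω) ∈ S j ↔ IsFirstArgmax I (D ω) j := by
    intro j ω
    simp [S, V, D, IsFirstArgmax]
  have hVm : ∀ j, AEMeasurable (V j) P := fun j ↦ aemeasurable_pi_lambda _ fun k ↦
    (hW.aemeasurable k).sub ((hW.aemeasurable j).const_mul _)
  have hSm : ∀ j, MeasurableSet (S j) := by
    intro j
    have : S j = ⋂ k ∈ I, {p | (k < j → p.1 k + ρ j k * p.2 - a k < p.2 - a j) ∧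
        (j < k → p.1 k + ρ j k * p.2 - a k ≤ p.2 - a j)} := by ext; simp [S]
    rw [this]
    refine Finset.measurableSet_biInter _ fun k _ ↦ ?_
    refine MeasurableSet.inter ?_ ?_
    · by_cases h : k < j
      · simp only [h, forall_const]
        exact measurableSet_lt (by fun_prop) (by fun_prop)
      · simp only [h, false_imp_iff]; exact MeasurableSet.univ
    · by_cases h : j < k
      · simp only [h, forall_const]
        exact measurableSet_le (by fun_prop) (by fun_prop)
      · simp only [h, false_imp_iff]; exact MeasurableSet.univ
  -- With the residuals fixed, the competitor `k` grows with slope `ρ j k ≤ 1` in `W j`, while `j`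
  -- itself grows with slope 1.
  have hup : ∀ j v, IsUpperSet (Prod.mk v ⁻¹' S j) := by
    intro j v x y hxy hx k hk
    have hρ : ρ j k ≤ 1 :=
      covariance_le_one_of_variance_eq_one (hL2 k) (hL2 j) (hvar k) (hvar j)
    have h1 : (ρ j k - 1) * y ≤ (ρ j k - 1) * x := mul_le_mul_of_nonpos_left hxy (by linarith)
    obtain ⟨h2, h3⟩ := hx k hk
    simp only at h2 h3
    exact ⟨fun h ↦ by simp only; linarith [h2 h], fun h ↦ by simp only; linarith [h3 h]⟩
  have hstep : ∀ j, ENNReal.ofReal (1 - s * (1 + t)) *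
      P {ω | IsFirstArgmax I (D ω) j ∧ a j < W j ω}
      ≤ P {ω | IsFirstArgmax I (D ω) j ∧ a j + s < W j ω} := by
    intro j
    have hlaw : P.map (W j) = gaussianReal 0 1 := by
      rw [(hW.hasGaussianLaw_eval j).map_eq_gaussianReal, hmean j, hvar j, Real.toNNReal_one]
    have := (hW.indepFun_residual j (hvar j)).mul_measure_inter_gt_le (hVm j)
      (hW.aemeasurable j) hlaw (hSm j) (hup j) (ha j) (hat j) hs
    simpa only [← hVS] using this
  have hcover : {ω | ∃ k ∈ I, a k < W k ω}
      ⊆ ⋃ j ∈ I, {ω | IsFirstArgmax I (D ω) j ∧ a j < W j ω} := by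
    rintro ω ⟨k, hk, hlt⟩
    obtain ⟨j, hj, hfirst⟩ := exists_isFirstArgmax ⟨k, hk⟩ (D ω)
    simp only [mem_iUnion]
    refine ⟨j, hj, hfirst, ?_⟩
    have := hfirst.le hk
    simp only [D] at this
    linarith
  calc ENNReal.ofReal (1 - s * (1 + t)) * P {ω | ∃ k ∈ I, a k < W k ω}
      ≤ ENNReal.ofReal (1 - s * (1 + t)) *
          ∑ j ∈ I, P {ω | IsFirstArgmax I (D ω) j ∧ a j < W j ω} := by
        gcongr
        exact (measure_mono hcover).trans (measure_biUnion_finset_le _ _)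
    _ ≤ ∑ j ∈ I, P {ω | IsFirstArgmax I (D ω) j ∧ a j + s < W j ω} := by
        rw [Finset.mul_sum]
        exact Finset.sum_le_sum fun j _ ↦ hstep j
    _ = P (⋃ j ∈ I, {ω | IsFirstArgmax I (D ω) j ∧ a j + s < W j ω}) := by
        refine (measure_biUnion_finset₀ (fun i hi j hj hij ↦ ?_) fun j _ ↦ ?_).symm
        · refine Disjoint.aedisjoint (Set.disjoint_left.2 fun ω h h' ↦ hij ?_)
          exact h.1.eq hi hj h'.1
        · simp only [← hVS]
          exact (((hVm j).prodMk (hW.aemeasurable j)).nullMeasurableSet_preimage (hSm j)).inter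
            ((hW.aemeasurable j).nullMeasurableSet_preimage measurableSet_Ioi)
    _ ≤ P {ω | ∃ k ∈ I, a k + s < W k ω} := by
        refine measure_mono fun ω hω ↦ ?_
        simp only [mem_iUnion] at hω
        obtain ⟨j, hj, -, h⟩ := hω
        exact ⟨j, hj, h⟩

/-- Raising the level `t` of a centered Gaussian sequence by `s` costs a controlled factor of the
exceedance probability. -/
lemma ProbabilityTheory.IsGaussianProcess.mul_measure_exists_nat_gt_le {Y : ℕ → Ω → ℝ}
    (hY : IsGaussianProcess Y P) (hmean : ∀ k, ∫ ω, Y k ω ∂P = 0) {σ : ℝ} (hσ : 0 < σ)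
    (hvar : ∀ k, σ ^ 2 ≤ Var[Y k; P]) {s t : ℝ} (hs : 0 ≤ s) (ht : 0 ≤ t) :
    ENNReal.ofReal (1 - s / σ * (1 + t / σ)) * P {ω | ∃ k, t < Y k ω}
      ≤ P {ω | ∃ k, t + s < Y k ω} := by
  set τ : ℕ → ℝ := fun k ↦ √(Var[Y k; P]) with hτ
  have hτσ : ∀ k, σ ≤ τ k := fun k ↦ Real.le_sqrt_of_sq_le (hvar k)
  have hτ0 : ∀ k, 0 < τ k := fun k ↦ hσ.trans_le (hτσ k)
  have hτsq : ∀ k, τ k ^ 2 = Var[Y k; P] := fun k ↦ Real.sq_sqrt (variance_nonneg _ _)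
  have hW : IsGaussianProcess (fun k ω ↦ (τ k)⁻¹ * Y k ω) P := hY.smul fun k ↦ (τ k)⁻¹
  have hWmean : ∀ k, ∫ ω, (τ k)⁻¹ * Y k ω ∂P = 0 := fun k ↦ by
    rw [integral_const_mul, hmean, mul_zero]
  have hWvar : ∀ k, Var[fun ω ↦ (τ k)⁻¹ * Y k ω; P] = 1 := fun k ↦ by
    rw [variance_const_mul, ← hτsq, ← mul_pow, inv_mul_cancel₀ (hτ0 k).ne', one_pow]
  have hfin : ∀ n, ENNReal.ofReal (1 - s / σ * (1 + t / σ)) *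
      P {ω | ∃ k ∈ Finset.range n, t < Y k ω} ≤ P {ω | ∃ k, t + s < Y k ω} := by
    intro n
    -- Normalising turns the common level into the thresholds `t / τ k ≤ t / σ`. The shift `s / σ`
    -- dominates every `s / τ k`, so the shifted event still forces `Y k > t + s`.
    have h := hW.mul_measure_exists_gt_le hWmean hWvar (Finset.range n) (a := fun k ↦ t / τ k)
      (s := s / σ) (t := t / σ) (fun k ↦ div_nonneg ht (hτ0 k).le)
      (fun k ↦ div_le_div_of_nonneg_left ht hσ (hτσ k)) (div_nonneg hs hσ.le)
    refine le_trans (le_of_eq ?_) (h.trans (measure_mono ?_))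
    · congr 3 with ω
      refine exists_congr fun k ↦ and_congr_right fun _ ↦ ?_
      rw [div_eq_inv_mul, mul_lt_mul_iff_right₀ (inv_pos.2 (hτ0 k))]
    · rintro ω ⟨k, -, hk⟩
      refine ⟨k, ?_⟩
      have h1 : s / τ k ≤ s / σ := div_le_div_of_nonneg_left hs hσ (hτσ k)
      have h2 : (τ k)⁻¹ * (t + s) < (τ k)⁻¹ * Y k ω := by
        refine lt_of_le_of_lt ?_ hk
        rw [mul_add, ← div_eq_inv_mul, ← div_eq_inv_mul]
        gcongr
      exact (mul_lt_mul_iff_right₀ (inv_pos.2 (hτ0 k))).1 h2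
  have hU : {ω | ∃ k, t < Y k ω} = ⋃ n, {ω | ∃ k ∈ Finset.range n, t < Y k ω} := by
    ext ω
    simp only [mem_ofPred_eq, mem_iUnion]
    exact ⟨fun ⟨k, hk⟩ ↦ ⟨k + 1, k, by simp, hk⟩, fun ⟨_, k, _, hk⟩ ↦ ⟨k, hk⟩⟩
  have hmono : Monotone fun n ↦ {ω | ∃ k ∈ Finset.range n, t < Y k ω} := by
    rintro m n hmn ω ⟨k, hk, h⟩
    exact ⟨k, Finset.range_mono hmn hk, h⟩
  rw [hU, hmono.measure_iUnion, ENNReal.mul_iSup]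
  exact iSup_le hfin

/-! ### Square-integrability of the supremum -/

/-- A centered Gaussian vector is symmetric. -/
lemma ProbabilityTheory.HasGaussianLaw.map_neg_eq {E : Type*} [NormedAddCommGroup E]
    [NormedSpace ℝ E] [MeasurableSpace E] [BorelSpace E] [SecondCountableTopology E]
    [CompleteSpace E] {X : Ω → E} (hX : HasGaussianLaw X P)
    (hmean : ∀ L : StrongDual ℝ E, ∫ x, L x ∂(P.map X) = 0) :
    P.map (-X) = P.map X := by
  have hP := hX.isProbabilityMeasure
  have := hX.isGaussian_map
  have := hX.neg.isGaussian_map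
  refine Measure.ext_of_charFunDual ?_
  ext L
  have h1 : P.map (-X) = (P.map X).map (ContinuousLinearEquiv.neg ℝ) := by
    rw [AEMeasurable.map_map_of_aemeasurable (by fun_prop) hX.aemeasurable]
    rfl
  rw [IsGaussian.charFunDual_eq_of_forall_strongDual_eq_zero hmean, h1]
  have hmean' : ∀ L : StrongDual ℝ E,
      ∫ x, L x ∂((P.map X).map (ContinuousLinearEquiv.neg ℝ)) = 0 := by
    intro L
    rw [integral_map (by fun_prop) (by fun_prop)]
    simp [integral_neg, hmean L]
  rw [IsGaussian.charFunDual_eq_of_forall_strongDual_eq_zero hmean',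
    variance_map (by fun_prop) (by fun_prop)]
  have : (L ∘ (ContinuousLinearEquiv.neg ℝ : E ≃L[ℝ] E)) = -L := by ext; simp
  rw [this]
  simp [variance_neg]

/-- Uniform second moment bound for centered Gaussian measures that give mass at least `3 / 4` to a
fixed ball. -/
lemma exists_forall_lintegral_norm_sq_le {a : ℝ} (ha : 0 < a) : ∃ K : ℝ≥0∞, K ≠ ∞ ∧
    ∀ (n : ℕ) (μ : Measure (Finset.range n → ℝ)) [IsGaussian μ],
      (∀ L : StrongDual ℝ (Finset.range n → ℝ), ∫ x, L x ∂μ = 0) →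
      ENNReal.ofReal (3 / 4) ≤ μ {x | ‖x‖ ≤ a} → ∫⁻ x, ‖x‖ₑ ^ 2 ∂μ ≤ K := by
  set c := ENNReal.ofReal (3 / 4) with hc
  have hc1 : 2⁻¹ < c := by
    rw [hc, ← ENNReal.ofReal_ofNat 2, ← ENNReal.ofReal_inv_of_pos (by norm_num)]
    exact (ENNReal.ofReal_lt_ofReal_iff (by norm_num)).2 (by norm_num)
  have hc2 : c < 1 := by
    rw [hc, ← ENNReal.ofReal_one]
    exact (ENNReal.ofReal_lt_ofReal_iff (by norm_num)).2 (by norm_num)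
  have hlog := Fernique.logRatio_pos hc1 hc2
  -- The constant in Fernique's bound depends on the mass `c` alone, hence neither on the dimension
  -- nor on the measure.
  set K₀ : ℝ≥0∞ := .ofReal (Real.exp (Fernique.logRatio c))
        + ∑' n, .ofReal (Real.exp (-2⁻¹ * Real.log (c / (1 - c)).toReal * 2 ^ n)) with hK₀
  have hcr : (c / (1 - c)).toReal = 3 := by
    rw [hc, ← ENNReal.ofReal_one, ← ENNReal.ofReal_sub _ (by norm_num),
      ← ENNReal.ofReal_div_of_pos (by norm_num), ENNReal.toReal_ofReal (by norm_num)]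
    norm_num
  have hK₀top : K₀ ≠ ∞ := by
    refine (ENNReal.add_lt_top.mpr ⟨ENNReal.ofReal_lt_top, ?_⟩).ne
    refine Summable.tsum_ofReal_lt_top <|
      Real.summable_exp_nat_mul_of_ge ?_ (fun i ↦ mod_cast (Nat.lt_pow_self (by simp)).le)
    rw [hcr]
    exact mul_neg_of_neg_of_pos (by norm_num) (Real.log_pos (by norm_num))
  set C := Fernique.logRatio c * a⁻¹ ^ 2 with hC
  have hC0 : 0 < C := by positivity
  refine ⟨ENNReal.ofReal C⁻¹ * K₀, ENNReal.mul_ne_top ENNReal.ofReal_ne_top hK₀top, ?_⟩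
  intro n μ _ hmean hball
  have hF := lintegral_exp_mul_sq_norm_le_of_map_rotation_eq_self
    (IsGaussian.map_rotation_eq_self_of_forall_strongDual_eq_zero hmean _) hball hc1
  refine le_trans ?_ (mul_le_mul_right hF _)
  rw [← lintegral_const_mul' _ _ ENNReal.ofReal_ne_top]
  refine lintegral_mono fun x ↦ ?_
  rw [← ofReal_norm, ← ENNReal.ofReal_pow (norm_nonneg _),
    ← ENNReal.ofReal_mul (inv_nonneg.2 hC0.le)]
  refine ENNReal.ofReal_le_ofReal ?_
  rw [← div_eq_inv_mul, le_div_iff₀ hC0, mul_comm]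
  linarith [Real.add_one_le_exp (C * ‖x‖ ^ 2)]

lemma ProbabilityTheory.IsGaussianProcess.integral_dual_map_restrict_eq_zero {ι : Type*}
    {Y : ι → Ω → ℝ} (hY : IsGaussianProcess Y P) (hmean : ∀ k, ∫ ω, Y k ω ∂P = 0) (I : Finset ι)
    (L : StrongDual ℝ (I → ℝ)) : ∫ x, L x ∂(P.map fun ω ↦ I.restrict (Y · ω)) = 0 := by
  have h := (hY.hasGaussianLaw I)
  have := h.isGaussian_map
  rw [IsGaussian.integral_dual, integral_map h.aemeasurable (by fun_prop)]
  convert map_zero L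
  ext k
  refine ((eval_integral (f := fun ω ↦ I.restrict (Y · ω))
    fun i ↦ (hY.hasGaussianLaw_eval i).integrable) k).trans ?_
  exact hmean k

/-- If a centered Gaussian sequence stays below `a > 0` with probability at least `7 / 8`, then its
first `n` terms are in absolute value at most `a` with probability at least `3 / 4`. -/
lemma ProbabilityTheory.IsGaussianProcess.le_map_restrict_norm_le {Y : ℕ → Ω → ℝ}
    (hY : IsGaussianProcess Y P) (hmean : ∀ k, ∫ ω, Y k ω ∂P = 0) {a : ℝ} (ha : 0 < a)
    (h : P {ω | ∃ k, a < Y k ω} ≤ ENNReal.ofReal (1 / 8)) (n : ℕ) :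
    ENNReal.ofReal (3 / 4) ≤
      (P.map fun ω ↦ (Finset.range n).restrict (Y · ω)) {x | ‖x‖ ≤ a} := by
  have hv := hY.hasGaussianLaw (Finset.range n)
  set v : Ω → Finset.range n → ℝ := fun ω ↦ (Finset.range n).restrict (Y · ω) with hvdef
  have hP := hY.isProbabilityMeasure
  have := hv.isGaussian_map
  have hm : MeasurableSet {x : Finset.range n → ℝ | ∃ k, a < x k} := by
    have : {x : Finset.range n → ℝ | ∃ k, a < x k} = ⋃ k, {x | a < x k} := by ext; simp
    rw [this]
    exact MeasurableSet.iUnion fun k ↦ measurableSet_lt measurable_const (measurable_pi_apply k)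
  have h1 : P.map v {x | ∃ k, a < x k} ≤ ENNReal.ofReal (1 / 8) := by
    rw [Measure.map_apply_of_aemeasurable hv.aemeasurable hm]
    refine (measure_mono ?_).trans h
    rintro ω ⟨k, hk⟩
    exact ⟨k, hk⟩
  -- Symmetry carries the one-sided bound over to the negated vector; the two exceptional masses add
  -- up to `1 / 4`.
  have h2 : P.map v {x | ∃ k, a < (-x) k} ≤ ENNReal.ofReal (1 / 8) := by
    rw [← hv.map_neg_eq (hY.integral_dual_map_restrict_eq_zero hmean _)] at h1
    rw [Measure.map_apply_of_aemeasurable hv.neg.aemeasurable hm] at h1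
    exact (Measure.map_apply_of_aemeasurable hv.aemeasurable (measurable_neg hm)).trans_le h1
  have hsub : {x : Finset.range n → ℝ | ‖x‖ ≤ a}ᶜ
      ⊆ {x | ∃ k, a < x k} ∪ {x | ∃ k, a < (-x) k} := by
    intro x hx
    simp only [mem_compl_iff, mem_ofPred_eq, pi_norm_le_iff_of_nonneg ha.le, not_forall, not_le,
      Real.norm_eq_abs, lt_abs] at hx
    obtain ⟨k, hk | hk⟩ := hx
    · exact Or.inl ⟨k, hk⟩
    · exact Or.inr ⟨k, hk⟩
  have h3 : P.map v {x | ‖x‖ ≤ a}ᶜ ≤ ENNReal.ofReal (1 / 4) := by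
    refine (measure_mono hsub).trans ((measure_union_le _ _).trans ((add_le_add h1 h2).trans ?_))
    rw [← ENNReal.ofReal_add (by norm_num) (by norm_num)]
    norm_num
  rw [prob_compl_eq_one_sub (measurableSet_le measurable_norm measurable_const),
    tsub_le_iff_right] at h3
  rw [← ENNReal.add_le_add_iff_right (ENNReal.ofReal_ne_top (r := 1 / 4)),
    ← ENNReal.ofReal_add (by norm_num) (by norm_num), add_comm _ (ENNReal.ofReal (1 / 4))]
  refine le_trans (le_of_eq ?_) h3
  norm_num

/-- The almost surely finite supremum of a centered Gaussian sequence is square-integrable. -/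
lemma ProbabilityTheory.IsGaussianProcess.memLp_two_of_isLUB {Y : ℕ → Ω → ℝ}
    (hY : IsGaussianProcess Y P) (hmean : ∀ k, ∫ ω, Y k ω ∂P = 0) {Z : Ω → ℝ}
    (hZ : ∀ᵐ ω ∂P, IsLUB (range fun k ↦ Y k ω) (Z ω)) : MemLp Z 2 P := by
  have hP := hY.isProbabilityMeasure
  have hZm : AEMeasurable Z P := AEMeasurable.isLUB hY.aemeasurable hZ
  -- Almost sure finiteness of the supremum makes the exceedance events decrease to a null set.
  obtain ⟨a, ha, hPa⟩ : ∃ a : ℝ, 0 < a ∧ P {ω | ∃ k, a < Y k ω} ≤ ENNReal.ofReal (1 / 8) := by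
    have hnull : ∀ N : ℕ, NullMeasurableSet {ω | ∃ k, (N : ℝ) < Y k ω} P := fun N ↦ by
      have : {ω | ∃ k, (N : ℝ) < Y k ω} = ⋃ k, {ω | (N : ℝ) < Y k ω} := by ext; simp
      rw [this]
      exact NullMeasurableSet.iUnion fun k ↦
        (hY.aemeasurable k).nullMeasurableSet_preimage measurableSet_Ioi
    have hanti : Antitone fun N : ℕ ↦ {ω | ∃ k, (N : ℝ) < Y k ω} := by
      rintro M N hMN ω ⟨k, hk⟩
      exact ⟨k, lt_of_le_of_lt (by exact_mod_cast hMN) hk⟩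
    have hlim := tendsto_measure_iInter_atTop (μ := P) hnull hanti ⟨0, measure_ne_top _ _⟩
    have hzero : P (⋂ N : ℕ, {ω | ∃ k, (N : ℝ) < Y k ω}) = 0 := by
      refine measure_mono_null ?_ (ae_iff.1 hZ)
      intro ω hω hlub
      obtain ⟨N, hN⟩ := exists_nat_ge (Z ω)
      obtain ⟨k, hk⟩ := mem_iInter.1 hω N
      linarith [hlub.1 (mem_range_self k)]
    rw [hzero] at hlim
    have hev := hlim.eventually_lt_const
      (show (0 : ℝ≥0∞) < ENNReal.ofReal (1 / 8) from ENNReal.ofReal_pos.2 (by norm_num))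
    obtain ⟨N, hN, hN1⟩ := (hev.and (eventually_ge_atTop 1)).exists
    exact ⟨N, by exact_mod_cast hN1, hN.le⟩
  obtain ⟨K, hK, hbound⟩ := exists_forall_lintegral_norm_sq_le ha
  let M : ℕ → Ω → ℝ := fun n ω ↦ partialSups (fun k ↦ Y k ω) n
  have hMm : ∀ n, AEMeasurable (M n) P := by
    intro n
    induction n with
    | zero => simpa [M] using hY.aemeasurable 0
    | succ n ih =>
      have : M (n + 1) = fun ω ↦ M n ω ⊔ Y (n + 1) ω := by
        ext ω
        exact partialSups_add_one _ _
      rw [this]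
      exact ih.sup (hY.aemeasurable _)
  have hMlim : ∀ᵐ ω ∂P, Tendsto (fun n ↦ M n ω) atTop (𝓝 (Z ω)) := by
    filter_upwards [hZ] with ω hω
    refine tendsto_atTop_isLUB (partialSups fun k ↦ Y k ω).monotone ?_
    rwa [IsLUB, upperBounds_range_partialSups]
  have hMle : ∀ n ω, ‖M n ω‖ ≤ ‖(Finset.range (n + 1)).restrict (Y · ω)‖ := by
    intro n ω
    have hk : ∀ k, k ≤ n → |Y k ω| ≤ ‖(Finset.range (n + 1)).restrict (Y · ω)‖ := fun k hk ↦
      norm_le_pi_norm ((Finset.range (n + 1)).restrict (Y · ω)) ⟨k, by simp; omega⟩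
    rw [Real.norm_eq_abs, abs_le]
    refine ⟨?_, partialSups_le _ _ _ fun k h ↦ (le_abs_self _).trans (hk k h)⟩
    exact (abs_le.1 (hk 0 (Nat.zero_le _))).1.trans
      (le_partialSups_of_le (fun k ↦ Y k ω) (Nat.zero_le n))
  have hMint : ∀ n, eLpNorm (M n) 2 P ≤ K ^ (1 / 2 : ℝ) := by
    intro n
    have hv := hY.hasGaussianLaw (Finset.range (n + 1))
    have := hv.isGaussian_map
    have h1 := hbound (n + 1) _ (hY.integral_dual_map_restrict_eq_zero hmean _)
      (hY.le_map_restrict_norm_le hmean ha hPa (n + 1))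
    rw [lintegral_map' (by fun_prop) hv.aemeasurable] at h1
    rw [eLpNorm_eq_lintegral_rpow_enorm_toReal (by norm_num) (by norm_num)]
    simp only [ENNReal.toReal_ofNat, ENNReal.rpow_ofNat]
    gcongr
    refine le_trans (lintegral_mono fun ω ↦ ?_) h1
    gcongr
    exact enorm_le_iff_norm_le.2 (hMle n ω)
  refine ⟨hZm.aestronglyMeasurable, ?_⟩
  -- Fatou passes the uniform bound from the running maxima to their limit `Z`.
  have := Lp.eLpNorm_lim_le_liminf_eLpNorm (p := 2)
    (fun n ↦ (hMm n).aestronglyMeasurable) Z hMlim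
  refine this.trans_lt (lt_of_le_of_lt (b := K ^ (1 / 2 : ℝ)) ?_
    (ENNReal.rpow_lt_top_of_nonneg (by norm_num) hK))
  exact (liminf_le_liminf (Eventually.of_forall hMint)).trans (by simp)

/-! ### Variance bound for sequences -/

lemma ProbabilityTheory.HasGaussianLaw.one_half_le_measure_pos {Y : Ω → ℝ}
    (hY : HasGaussianLaw Y P) (hmean : ∫ ω, Y ω ∂P = 0) (hvar : 0 < Var[Y; P]) :
    ENNReal.ofReal (1 / 2) ≤ P {ω | 0 < Y ω} := by
  have h : P {ω | 0 < Y ω} = P.map Y (Ioi 0) :=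
    (Measure.map_apply_of_aemeasurable hY.aemeasurable measurableSet_Ioi).symm
  have hv : Var[Y; P].toNNReal ≠ 0 := (Real.toNNReal_pos.2 hvar).ne'
  rw [h, hY.map_eq_gaussianReal, hmean]
  set μ := gaussianReal 0 Var[Y; P].toNNReal with hμ
  have := nullSingletonClass_gaussianReal (μ := 0) hv
  have hneg : μ (Iic 0) = μ (Ioi 0) := by
    have h1 : μ.map (fun x ↦ -x) = μ := by rw [hμ, gaussianReal_map_neg, neg_zero]
    conv_lhs => rw [← h1]
    rw [Measure.map_apply measurable_neg measurableSet_Iic]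
    have : (fun x : ℝ ↦ -x) ⁻¹' Iic 0 = Ici 0 := by ext; simp
    rw [this]
    exact Ioi_ae_eq_Ici.measure_eq.symm
  have hsum := prob_compl_eq_one_sub (μ := μ) (measurableSet_Ioi (a := (0 : ℝ)))
  rw [compl_Ioi, hneg] at hsum
  have h2 : (1 : ℝ≥0∞) ≤ μ (Ioi 0) + μ (Ioi 0) := tsub_le_iff_right.1 hsum.ge
  rw [← two_mul] at h2
  have h3 : ENNReal.ofReal (1 / 2) = 2⁻¹ := by
    rw [one_div, ENNReal.ofReal_inv_of_pos (by norm_num), ENNReal.ofReal_ofNat]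
  rw [h3]
  exact ENNReal.inv_le_iff_le_mul (by simp) (by simp) |>.2 h2

/-- Integrability, nonnegative mean and a lower variance bound for the supremum of a centered
Gaussian sequence whose variances are bounded from below. -/
theorem ProbabilityTheory.IsGaussianProcess.variance_isLUB_ge {Y : ℕ → Ω → ℝ}
    (hY : IsGaussianProcess Y P) (hmean : ∀ k, ∫ ω, Y k ω ∂P = 0) {σ : ℝ} (hσ : 0 < σ)
    (hvar : ∀ k, σ ^ 2 ≤ Var[Y k; P]) {Z : Ω → ℝ}
    (hZ : ∀ᵐ ω ∂P, IsLUB (range fun k ↦ Y k ω) (Z ω)) :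
    Integrable Z P ∧ 0 ≤ ∫ ω, Z ω ∂P ∧
      1 / 15 ^ 2 * (σ / (1 + ∫ ω, Z ω / σ ∂P)) ^ 2 ≤ Var[Z; P] := by
  have hP := hY.isProbabilityMeasure
  have hL2 := hY.memLp_two_of_isLUB hmean hZ
  have hint : Integrable Z P := hL2.integrable (by norm_num)
  have hm0 : 0 ≤ ∫ ω, Z ω ∂P := by
    rw [← hmean 0]
    refine integral_mono_ae (hY.hasGaussianLaw_eval 0).integrable hint ?_
    filter_upwards [hZ] with ω hω using hω.1 (mem_range_self 0)
  refine ⟨hint, hm0, ?_⟩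
  rw [integral_div]
  set m := ∫ ω, Z ω ∂P with hm
  have hmσ : 0 ≤ m / σ := div_nonneg hm0 hσ.le
  set η : ℝ := σ / (15 * (1 + m / σ)) with hη
  have hη0 : 0 < η := by positivity
  have hησ : η / σ * (1 + m / σ) = 1 / 15 := by
    rw [hη]
    have : 1 + m / σ ≠ 0 := by positivity
    field_simp
  have hgoal : 1 / 15 ^ 2 * (σ / (1 + m / σ)) ^ 2 = η ^ 2 := by
    rw [hη, mul_comm 15, ← div_div, div_pow _ (15 : ℝ)]
    ring
  rw [hgoal]
  by_contra! hlt
  -- Three times `η` is the Chebyshev radius: the window around `m` has width `6 * η` and misses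
  -- mass at most `1 / 9`.
  have hcheb : P {ω | 3 * η ≤ |Z ω - m|} ≤ ENNReal.ofReal (1 / 9) := by
    refine (meas_ge_le_variance_div_sq hL2 (by positivity)).trans (ENNReal.ofReal_le_ofReal ?_)
    rw [div_le_iff₀ (by positivity)]
    nlinarith
  have hexc : ∀ c, P {ω | ∃ k, c < Y k ω} = P {ω | c < Z ω} := fun c ↦ by
    refine measure_congr ?_
    filter_upwards [hZ] with ω hω
    refine propext ?_
    change (∃ k, c < Y k ω) ↔ c < Z ω
    rw [lt_isLUB_iff hω, exists_range_iff]
  -- Truncation at 0 meets the requirement `t ≥ 0` of the tail comparison. The level is still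
  -- exceeded with probability at least `1 / 2`: by Chebyshev if `t = m - 3 * η`, by symmetry of `Y
  -- 0` if `t = 0`.
  set t := max 0 (m - 3 * η) with ht
  have ht0 : 0 ≤ t := le_max_left _ _
  have htm : t ≤ m := max_le hm0 (by linarith)
  have hhalf : ENNReal.ofReal (1 / 2) ≤ P {ω | ∃ k, t < Y k ω} := by
    rcases le_total (m - 3 * η) 0 with h | h
    · rw [ht, max_eq_left h]
      refine ((hY.hasGaussianLaw_eval 0).one_half_le_measure_pos (hmean 0)
        ((by positivity : 0 < σ ^ 2).trans_le (hvar 0))).trans (measure_mono fun ω hω ↦ ⟨0, hω⟩)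
    · rw [hexc, ht, max_eq_right h]
      have h1 : {ω | m - 3 * η < Z ω}ᶜ ⊆ {ω | 3 * η ≤ |Z ω - m|} := by
        intro ω hω
        simp only [mem_compl_iff, mem_ofPred_eq, not_lt] at hω
        rw [mem_ofPred_eq, le_abs]
        exact Or.inr (by linarith)
      have h2 := (measure_mono h1).trans hcheb
      have hnull : NullMeasurableSet {ω | m - 3 * η < Z ω} P :=
        hL2.aestronglyMeasurable.aemeasurable.nullMeasurableSet_preimage measurableSet_Ioi
      rw [prob_compl_eq_one_sub₀ hnull, tsub_le_iff_left] at h2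
      rw [← ENNReal.add_le_add_iff_right (ENNReal.ofReal_ne_top (r := 1 / 9))]
      refine le_trans ?_ h2
      rw [← ENNReal.ofReal_add (by norm_num) (by norm_num), ← ENNReal.ofReal_one]
      exact ENNReal.ofReal_le_ofReal (by norm_num)
  -- Here the constant 15 enters: the loss is at most `6 / 15`. The kept mass `3 / 5 * 1 / 2`
  -- exceeds the `1 / 9` that Chebyshev allows above `t + 6 * η ≥ m + 3 * η`.
  have hfactor : 3 / 5 ≤ 1 - 6 * η / σ * (1 + t / σ) := by
    have h1 : 6 * η / σ * (1 + t / σ) ≤ 6 * η / σ * (1 + m / σ) := by gcongr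
    have h2 : 6 * η / σ * (1 + m / σ) = 6 * (η / σ * (1 + m / σ)) := by ring
    rw [h2, hησ] at h1
    linarith
  have htail := hY.mul_measure_exists_nat_gt_le hmean hσ hvar (s := 6 * η) (by positivity) ht0
  have hupper : P {ω | ∃ k, t + 6 * η < Y k ω} ≤ ENNReal.ofReal (1 / 9) := by
    rw [hexc]
    refine (measure_mono fun ω hω ↦ ?_).trans hcheb
    have h1 : t + 6 * η < Z ω := hω
    have h2 : m - 3 * η ≤ t := le_max_right _ _
    rw [mem_ofPred_eq, le_abs]
    exact Or.inl (by linarith)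
  have hcontra : ENNReal.ofReal (3 / 5) * ENNReal.ofReal (1 / 2) ≤ ENNReal.ofReal (1 / 9) :=
    (mul_le_mul' (ENNReal.ofReal_le_ofReal hfactor) hhalf).trans (htail.trans hupper)
  rw [← ENNReal.ofReal_mul (by norm_num), ENNReal.ofReal_le_ofReal_iff (by norm_num)] at hcontra
  norm_num at hcontra

end

/-! ### Reduction of separable processes to sequences -/

theorem mainTheorem7 {Ω U : Type*} [MeasurableSpace Ω] (P : Measure Ω) [IsProbabilityMeasure P]
    [PseudoMetricSpace U] [Nonempty U] (X : U → Ω → ℝ)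
    (hsep : IsSeparableProcess X P) (hX : IsCenteredGaussianProcess X P)
    (σ : ℝ) (hσ : 0 < σ) (hvar : ∀ u, σ ^ 2 ≤ Var[X u; P]) :
    -- the supremum `Z ω = ⨆ u, X u ω`, assumed almost surely finite
    (∀ Z : Ω → ℝ, (∀ ω, Z ω = ⨆ u, X u ω) →
      (∀ᵐ ω ∂P, BddAbove (Set.range fun u => X u ω)) →
        Integrable Z P ∧ 0 ≤ ∫ ω, Z ω ∂P ∧
          1 / 15 ^ 2 * (σ / (1 + ∫ ω, Z ω / σ ∂P)) ^ 2 ≤ Var[Z; P]) ∧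
    -- the same for `Z ω = ⨆ u, |X u ω|`
    (∀ Z : Ω → ℝ, (∀ ω, Z ω = ⨆ u, |X u ω|) →
      (∀ᵐ ω ∂P, BddAbove (Set.range fun u => |X u ω|)) →
        Integrable Z P ∧ 0 ≤ ∫ ω, Z ω ∂P ∧
          1 / 15 ^ 2 * (σ / (1 + ∫ ω, Z ω / σ ∂P)) ^ 2 ≤ Var[Z; P]) := by
  obtain ⟨U₀, hU₀, hclos⟩ := hsep
  have hne : U₀.Nonempty := by
    obtain ⟨ω, hω⟩ := hclos.exists
    obtain ⟨_, v, hv, _⟩ := closure_nonempty_iff.1 ⟨_, hω (Classical.arbitrary U) 1 one_pos⟩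
    exact ⟨v, hv.1⟩
  have hmem : ∀ᵐ ω ∂P, ∀ u, X u ω ∈ closure ((fun v ↦ X v ω) '' U₀) := by
    filter_upwards [hclos] with ω hω u
    exact closure_mono (image_mono inter_subset_left) (hω u 1 one_pos)
  constructor
  · intro Z hZ hbdd
    obtain ⟨f, rfl⟩ := hU₀.exists_eq_range hne
    refine (hX.isGaussian.comp_right f).variance_isLUB_ge (fun k ↦ hX.mean_zero (f k)) hσ
      (fun k ↦ hvar (f k)) ?_
    -- Only a null set is discarded here, so the default value of `⨆` on unbounded families is
    -- harmless.
    filter_upwards [hmem, hbdd] with ω hω hb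
    rw [hZ ω]
    refine ⟨?_, fun b hb' ↦ ciSup_le fun u ↦ ?_⟩
    · rintro _ ⟨k, rfl⟩
      exact le_ciSup hb (f k)
    · refine closure_minimal (t := Iic b) ?_ isClosed_Iic (hω u)
      rintro _ ⟨_, ⟨k, rfl⟩, rfl⟩
      exact hb' (mem_range_self k)
  · intro Z hZ hbdd
    -- Since `|x| = max x (-x)`, the supremum of absolute values is that of the signed process `c *
    -- X v` with `c = ±1`, which is again centered Gaussian with the same variances.
    obtain ⟨g, hg⟩ := (hU₀.prod (toFinite ({1, -1} : Set ℝ)).countable).exists_eq_range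
      (hne.prod (insert_nonempty _ _))
    have hg1 : ∀ k, (g k).2 = 1 ∨ (g k).2 = -1 := fun k ↦ by
      have : g k ∈ U₀ ×ˢ ({1, -1} : Set ℝ) := hg ▸ mem_range_self k
      simpa using this.2
    have hgsq : ∀ k, (g k).2 ^ 2 = 1 := fun k ↦ by rcases hg1 k with h | h <;> simp [h]
    refine ((hX.isGaussian.comp_right fun k ↦ (g k).1).smul fun k ↦ (g k).2).variance_isLUB_ge
      (fun k ↦ ?_) hσ (fun k ↦ ?_) ?_
    · simp [integral_const_mul, hX.mean_zero]
    · simp only [smul_eq_mul, Function.comp_apply]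
      rw [variance_const_mul, hgsq, one_mul]
      exact hvar _
    filter_upwards [hmem, hbdd] with ω hω hb
    rw [hZ ω]
    refine ⟨?_, fun b hb' ↦ ciSup_le fun u ↦ ?_⟩
    · rintro _ ⟨k, rfl⟩
      refine le_trans ?_ (le_ciSup hb (g k).1)
      rcases hg1 k with h | h
      · simpa [h] using le_abs_self _
      · simpa [h] using neg_le_abs _
    · refine closure_minimal (t := {x | |x| ≤ b}) ?_
        (isClosed_le continuous_abs continuous_const) (hω u)
      rintro _ ⟨v, hv, rfl⟩
      have hsign : ∀ c ∈ ({1, -1} : Set ℝ), c * X v ω ≤ b := by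
        intro c hc
        have : (v, c) ∈ range g := hg ▸ ⟨hv, hc⟩
        obtain ⟨k, hk⟩ := this
        have := hb' (mem_range_self k)
        simpa [hk] using this
      exact abs_le'.2 ⟨by simpa using hsign 1 (by simp), by simpa using hsign (-1) (by simp)⟩
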